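/- Let $(\Omega,\mathcal F,(\mathcal F_t)_{t\in[0,T]},P)$ be a filtered probability space satisfying the usual conditions, and let $S$ be an $\mathbb R^d$-valued semimartingale on it with $S^*_T:=\sup_{t\le T}|S_t|\in L^1(P)$. Let $\mathcal K$ be the linear space of terminal gains of simple, predictable, bounded strategies, that is, of all random variables $$K=\sum_{i=1}^{n-1} H_i\cdot(S_{\tau_{i+1}}-S_{\tau_i}),$$ where $0\le\tau_1\le\dots\le\tau_n\le T$ are stopping times and each $H_i$ is bounded, $\mathbb R^d$-valued and $\mathcal F_{\tau_i}$-measurable. For $K\in\mathcal K$ with $P(K\neq 0)>0$ put $\alpha(K)=E[K^+]/E[K^-]\in[0,+\infty]$ (with $c/0=+\infty$ for $c>0$), and let $$\alpha^*=\sup\{\alpha(K) : K\in\mathcal K,\ P(K\ne 0)>0\}\in[0,+\infty].$$ An equivalent martingale probability is a probability $Q\sim P$ under which $S$ is a martingale with respect to $(\mathcal F_t)$. Let $\mathcal M_\infty$ be the set of equivalent martingale probabilities $Q$ for which there are constants $0<c<C<\infty$ with $c<\frac{dQ}{dP}\le C$ $P$-a.s. Let $\lambda\in(1,+\infty)$.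 The following conditions are equivalent: a) the market is $\lambda$ gain-loss free, that is, $\alpha^*<\lambda$; b) there exists an equivalent martingale probability $Q$ such that $$\frac{\operatorname{ess\,sup}\frac{dQ}{dP}}{\operatorname{ess\,inf}\frac{dQ}{dP}}<\lambda .$$ If either of these conditions holds, and if $\mathcal K$ contains some $K$ with $P(K\neq0)>0$ (so that the supremum defining $\alpha^*$ is not over the empty set), then $$\alpha^*=\min_{Q\in\mathcal M_\infty}\frac{\operatorname{ess\,sup}\frac{dQ}{dP}}{\operatorname{ess\,inf}\frac{dQ}{dP}},$$ the minimum being attained by some $Q\in\mathcal M_\infty$. -/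

import Mathlib

open MeasureTheory ProbabilityTheory Filter Topology
open scoped NNReal ENNReal

noncomputable section

namespace GainLoss

/-- The time interval `[0, T]`. -/
abbrev Time (T : ℝ≥0) : Type := Set.Iic T

/-- The space `ℝ^d` of values of the price process, with its Euclidean norm. -/
abbrev Vec (d : ℕ) : Type := EuclideanSpace ℝ (Fin d)

variable {Ω : Type*} {mΩ : MeasurableSpace Ω} {T : ℝ≥0} {d : ℕ}

/-- A path on `[0, T]` that is right continuous and has left limits. -/
def IsCadlagPath (f : Time T → Vec d) : Prop :=
  ∀ t, ContinuousWithinAt f (Set.Ici t) t ∧ ∃ l, Tendsto f (𝓝[<] t) (𝓝 l)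

/-- The usual assumptions: the filtration is right continuous and every `P`-null set belongs to
the initial σ-algebra (in particular the probability space is complete). -/
structure UsualConditions (𝓕 : Filtration (Time T) mΩ) (P : Measure Ω) : Prop where
  rightContinuous : 𝓕.IsRightContinuous
  complete : ∀ A : Set Ω, P A = 0 → MeasurableSet[𝓕 ⊥] A

/-- Càdlàg local martingales. -/
structure IsLocalMartingale (M : Time T → Ω → Vec d) (𝓕 : Filtration (Time T) mΩ)
    (P : Measure Ω) : Prop where
  adapted : StronglyAdapted 𝓕 M
  cadlag : ∀ᵐ ω ∂P, IsCadlagPath (fun t => M t ω)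
  locally_martingale : Locally (fun X : Time T → Ω → Vec d => Martingale X 𝓕 P) 𝓕 M P

/-- Càdlàg adapted processes whose paths have finite variation on `[0, T]`. -/
structure IsFiniteVariation (A : Time T → Ω → Vec d) (𝓕 : Filtration (Time T) mΩ)
    (P : Measure Ω) : Prop where
  adapted : StronglyAdapted 𝓕 A
  cadlag : ∀ᵐ ω ∂P, IsCadlagPath (fun t => A t ω)
  finite_variation : ∀ᵐ ω ∂P, BoundedVariationOn (fun t => A t ω) Set.univ

/-- A semimartingale is the sum of a local martingale and a process of finite variation. -/
def IsSemimartingale (S : Time T → Ω → Vec d) (𝓕 : Filtration (Time T) mΩ)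
    (P : Measure Ω) : Prop :=
  ∃ M A : Time T → Ω → Vec d,
    IsLocalMartingale M 𝓕 P ∧ IsFiniteVariation A 𝓕 P ∧ ∀ t ω, S t ω = M t ω + A t ω

/-- The maximal functional `S^*_T = sup_{t ≤ T} |S_t|`, with values in `[0, ∞]`. -/
def maximalFunctional (S : Time T → Ω → Vec d) (ω : Ω) : ℝ≥0∞ := ⨆ t, ‖S t ω‖ₑ

/-- A simple, predictable and bounded strategy `∑ i, H i • 1_{]τ i, τ (i + 1)]}`, with finitely many
`[0, T]`-valued stopping times `τ 0 ≤ τ 1 ≤ … ≤ τ n` and bounded `𝓕_{τ i}`-measurable positions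
`H i`. -/
structure SimpleStrategy (𝓕 : Filtration (Time T) mΩ) (d : ℕ) where
  /-- the number of holding periods -/
  n : ℕ
  /-- the trading dates -/
  τ : Fin (n + 1) → Ω → Time T
  isStoppingTime : ∀ i, IsStoppingTime 𝓕 (fun ω => (τ i ω : WithTop (Time T)))
  mono : ∀ ω, Monotone (fun i => τ i ω)
  /-- the positions held between consecutive trading dates -/
  H : Fin n → Ω → Vec d
  measurable : ∀ i, Measurable[(isStoppingTime i.castSucc).measurableSpace] (H i)
  bounded : ∃ C : ℝ, ∀ i ω, ‖H i ω‖ ≤ C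

/-- The terminal gain `ξ · S_T`, i.e. the sum of the `⟨H i, S_{τ (i + 1)} - S_{τ i}⟩`. -/
def SimpleStrategy.gain {𝓕 : Filtration (Time T) mΩ} (ξ : SimpleStrategy 𝓕 d)
    (S : Time T → Ω → Vec d) (ω : Ω) : ℝ :=
  ∑ i : Fin ξ.n, inner ℝ (ξ.H i ω) (S (ξ.τ i.succ ω) ω - S (ξ.τ i.castSucc ω) ω)

/-- The set `𝓚` of terminal admissible gains. -/
def gains (S : Time T → Ω → Vec d) (𝓕 : Filtration (Time T) mΩ) : Set (Ω → ℝ) :=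
  {K | ∃ ξ : SimpleStrategy 𝓕 d, K = ξ.gain S}

/-- The gain-loss ratio `α(K) = E[K⁺] / E[K⁻]`, with values in `[0, ∞]` and with `c / 0 = ∞` for
`c > 0`. -/
def gainLossRatio (P : Measure Ω) (K : Ω → ℝ) : ℝ≥0∞ :=
  (∫⁻ ω, ENNReal.ofReal (K ω) ∂P) / ∫⁻ ω, ENNReal.ofReal (-K ω) ∂P

/-- The market best gain-loss `α^*`, the supremum in `[0, ∞]` of `α(K)` over the gains `K` that do
not vanish almost surely. -/
def bestGainLoss (S : Time T → Ω → Vec d) (𝓕 : Filtration (Time T) mΩ) (P : Measure Ω) : ℝ≥0∞ :=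
  ⨆ K ∈ {K ∈ gains S 𝓕 | ¬ K =ᵐ[P] 0}, gainLossRatio P K

/-- The market is `lam` gain-loss free if `α^* < lam`. -/
def GainLossFree (S : Time T → Ω → Vec d) (𝓕 : Filtration (Time T) mΩ) (P : Measure Ω)
    (lam : ℝ) : Prop :=
  bestGainLoss S 𝓕 P < ENNReal.ofReal lam

/-- `Q` is an equivalent martingale probability for `S`. -/
structure IsEquivMartingaleProb (S : Time T → Ω → Vec d) (𝓕 : Filtration (Time T) mΩ)
    (P Q : Measure Ω) : Prop where
  isProbabilityMeasure : IsProbabilityMeasure Q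
  absolutelyContinuous : Q ≪ P
  absolutelyContinuous' : P ≪ Q
  martingale : Martingale S 𝓕 Q

/-- The ratio `ess sup (dQ/dP) / ess inf (dQ/dP)`, with values in `[0, ∞]`. -/
def densityRatio (P Q : Measure Ω) : ℝ≥0∞ :=
  essSup (Q.rnDeriv P) P / essInf (Q.rnDeriv P) P

/-- The set `𝓜_∞` of equivalent martingale probabilities whose density with respect to `P` is
bounded and bounded away from `0`. -/
def boundedMartingaleProbs (S : Time T → Ω → Vec d) (𝓕 : Filtration (Time T) mΩ)
    (P : Measure Ω) : Set (Measure Ω) :=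
  {Q | IsEquivMartingaleProb S 𝓕 P Q ∧
    (∃ C : ℝ≥0, ∀ᵐ ω ∂P, Q.rnDeriv P ω ≤ C) ∧
    ∃ c : ℝ≥0, 0 < c ∧ ∀ᵐ ω ∂P, c < Q.rnDeriv P ω}

end GainLoss

end

/-! Weak duality. Let `Q` be an equivalent martingale probability with `c ≤ dQ/dP ≤ C`. Optional
stopping gives `E_Q[K] = 0` for every gain `K`, so `c E[K⁺] ≤ E_Q[K⁺] = E_Q[K⁻] ≤ C E[K⁻]` and `α(K)
≤ C / c` (`bestGainLoss_le_densityRatio`).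

Strong duality. Put `α = α^*`, finite and at least `1` when some gain is nonzero (`K` and `-K`
compete). The sublinear functional `p(x) = E[max (α x) x] = α E[x⁺] - E[x⁻]` on `L¹` is the support
function of the densities with values in `[1, α]`. On a linear space of gains the bound `α(-x) ≤ α`
says `p ≥ 0`, so Hahn–Banach extends the zero functional to some `g ≤ p`. Domination by `p` makes
`g` integration against a measure `ν` with `P ≤ ν ≤ α P` (`exists_measure_of_le_supportFunctional`).
Normalising `ν` yields `Q` with density ratio at most `α`. It suffices to annihilate gains at
deterministic dates, since the increments `1_A ⟨v, S_t - S_s⟩` already characterise martingales.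
Weak duality then turns the bound into equality, so the minimum is attained. -/

namespace GainLoss

/-! ### Hahn–Banach duality for densities between `1` and `lam` -/

section Duality

variable {Ω : Type*} {mΩ : MeasurableSpace Ω} {P : Measure Ω}

/-- The support function `f ↦ sup {E[Z f] : 1 ≤ Z ≤ lam}` of the densities between `1` and
`lam`. -/
noncomputable def supportFunctional (P : Measure Ω) (lam : ℝ) (f : Ω →₁[P] ℝ) : ℝ :=
  ∫ ω, max (lam * f ω) (f ω) ∂P

lemma integrable_max_mul {f : Ω → ℝ} (hf : Integrable f P) (lam : ℝ) :
    Integrable (fun ω => max (lam * f ω) (f ω)) P :=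
  (hf.const_mul lam).sup hf

lemma supportFunctional_congr {lam : ℝ} {f : Ω →₁[P] ℝ} {x : Ω → ℝ} (h : f =ᵐ[P] x) :
    supportFunctional P lam f = ∫ ω, max (lam * x ω) (x ω) ∂P :=
  integral_congr_ae (h.mono fun ω hω => by simp only [hω])

lemma supportFunctional_smul (lam : ℝ) (c : ℝ) (hc : 0 < c) (f : Ω →₁[P] ℝ) :
    supportFunctional P lam (c • f) = c * supportFunctional P lam f := by
  rw [supportFunctional_congr (Lp.coeFn_smul c f), supportFunctional, ← integral_const_mul]
  congr with ω
  simp only [Pi.smul_apply, smul_eq_mul]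
  rw [mul_max_of_nonneg _ _ hc.le, mul_left_comm]

lemma supportFunctional_add_le (lam : ℝ) (f g : Ω →₁[P] ℝ) :
    supportFunctional P lam (f + g) ≤ supportFunctional P lam f + supportFunctional P lam g := by
  have hf := integrable_max_mul (L1.integrable_coeFn f) lam
  have hg := integrable_max_mul (L1.integrable_coeFn g) lam
  rw [supportFunctional_congr (Lp.coeFn_add f g), supportFunctional, supportFunctional,
    ← integral_add hf hg]
  refine integral_mono (integrable_max_mul
    ((L1.integrable_coeFn f).add (L1.integrable_coeFn g)) lam) (hf.add hg) fun ω => ?_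
  simp only [Pi.add_apply, mul_add]
  exact max_le (add_le_add (le_max_left _ _) (le_max_left _ _))
    (add_le_add (le_max_right _ _) (le_max_right _ _))

lemma supportFunctional_le_norm {lam : ℝ} (hlam : 1 ≤ lam) (f : Ω →₁[P] ℝ) :
    supportFunctional P lam f ≤ lam * ‖f‖ := by
  rw [L1.norm_eq_integral_norm, ← integral_const_mul]
  refine integral_mono (integrable_max_mul (L1.integrable_coeFn f) lam)
    ((L1.integrable_coeFn f).norm.const_mul lam) fun ω => ?_
  have h := le_abs_self (f ω)
  have h0 := abs_nonneg (f ω)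
  simp only [Real.norm_eq_abs]
  exact max_le (by gcongr) (by nlinarith)

/-- The sublinear functional `supportFunctional` is nonnegative at `x` when the gain-loss ratio of
`-x` is at most `lam`. -/
lemma integral_max_mul_nonneg {x : Ω → ℝ} (hx : Integrable x P) {lam : ℝ≥0} (hlam : 1 ≤ lam)
    (h : ∫⁻ ω, ENNReal.ofReal (-x ω) ∂P ≤ lam * ∫⁻ ω, ENNReal.ofReal (x ω) ∂P) :
    0 ≤ ∫ ω, max (lam * x ω) (x ω) ∂P := by
  have h1 : ∀ ω, max ((lam : ℝ) * x ω) (x ω) = lam * max (x ω) 0 - max (-x ω) 0 := by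
    intro ω
    have hl : (1 : ℝ) ≤ lam := by exact_mod_cast hlam
    rcases le_total 0 (x ω) with h | h
    · rw [max_eq_left (by nlinarith), max_eq_left h, max_eq_right (by linarith), sub_zero]
    · rw [max_eq_right (by nlinarith), max_eq_right h, max_eq_left (by linarith)]
      ring
  simp only [h1]
  have hp : Integrable (fun ω => max (x ω) 0) P := hx.pos_part
  have hn : Integrable (fun ω => max (-x ω) 0) P := hx.neg_part
  rw [integral_sub (hp.const_mul _) hn, integral_const_mul, sub_nonneg,
    integral_eq_lintegral_of_nonneg_ae (f := fun ω => max (x ω) 0)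
      (Eventually.of_forall fun ω => le_max_right _ _) hp.aestronglyMeasurable,
    integral_eq_lintegral_of_nonneg_ae (f := fun ω => max (-x ω) 0)
      (Eventually.of_forall fun ω => le_max_right _ _) hn.aestronglyMeasurable]
  simp only [ENNReal.ofReal_max, ENNReal.ofReal_zero, max_eq_left, zero_le]
  have := ENNReal.toReal_mono (ENNReal.mul_ne_top ENNReal.coe_ne_top hx.lintegral_lt_top.ne) h
  simpa using this

/-- A linear functional on `L¹` which is dominated by `supportFunctional` is the integral with
respect to a measure with density between `1` and `lam`. -/
theorem exists_measure_of_le_supportFunctional [IsProbabilityMeasure P] {lam : ℝ≥0}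
    (hlam : 1 ≤ lam) (g : (Ω →₁[P] ℝ) →ₗ[ℝ] ℝ) (hg : ∀ f, g f ≤ supportFunctional P lam f) :
    ∃ ν : Measure Ω, P ≤ ν ∧ ν ≤ lam • P ∧ ∀ f, g f = ∫ ω, f ω ∂ν := by
  classical
  have hl : (1 : ℝ) ≤ lam := by exact_mod_cast hlam
  have hg_norm f : |g f| ≤ lam * ‖f‖ := by
    refine abs_le.2 ⟨?_, (hg f).trans (supportFunctional_le_norm hl f)⟩
    have := (hg (-f)).trans (supportFunctional_le_norm hl (-f))
    rw [map_neg, norm_neg] at this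
    linarith
  let ι (s : Set Ω) (hs : MeasurableSet s) : Ω →₁[P] ℝ :=
    indicatorConstLp 1 hs (measure_ne_top P s) 1
  have hι s hs : ι s hs =ᵐ[P] s.indicator fun _ => (1 : ℝ) := indicatorConstLp_coeFn
  have hι_int {s : Set Ω} (hs : MeasurableSet s) (c : ℝ) :
      ∫ ω, s.indicator (fun _ => c) ω ∂P = P.real s * c := by
    rw [integral_indicator_const _ hs, smul_eq_mul]
  have hg_le s hs : g (ι s hs) ≤ lam * P.real s := by
    refine (hg _).trans_eq ?_
    rw [supportFunctional_congr (hι s hs), mul_comm, ← hι_int hs]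
    congr with ω
    by_cases hω : ω ∈ s <;> simp [hω, hl]
  -- The lower bound comes from testing with `-1_s`, where `max (-lam) (-1) = -1`.
  have hg_ge s hs : P.real s ≤ g (ι s hs) := by
    have h := hg (-ι s hs)
    rw [supportFunctional_congr (x := s.indicator fun _ => (-1 : ℝ)), map_neg] at h
    · have h2 : ∫ ω, max ((lam : ℝ) * s.indicator (fun _ => (-1 : ℝ)) ω)
          (s.indicator (fun _ => (-1 : ℝ)) ω) ∂P = P.real s * (-1) := by
        rw [← hι_int hs]
        congr with ω
        by_cases hω : ω ∈ s <;> simp [hω, hl]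
      linarith
    · filter_upwards [Lp.coeFn_neg (ι s hs), hι s hs] with ω h1 h2
      rw [h1, Pi.neg_apply, h2]
      by_cases hω : ω ∈ s <;> simp [hω]
  let m : Set Ω → ℝ := fun s => if hs : MeasurableSet s then g (ι s hs) else 0
  have hm {s} (hs : MeasurableSet s) : m s = g (ι s hs) := dif_pos hs
  have hm_nonneg s : 0 ≤ m s := by
    by_cases hs : MeasurableSet s
    · exact hm hs ▸ measureReal_nonneg.trans (hg_ge s hs)
    · simp [m, hs]
  -- Linearity of `g` gives finite additivity only; domination by the finite measure `lam • P`
  -- upgrades it to countable additivity.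
  let v : VectorMeasure Ω ℝ := VectorMeasure.of_additive_of_le_measure (μ := lam • P) m
    (by
      intro s
      by_cases hs : MeasurableSet s
      · rw [Real.enorm_of_nonneg (hm_nonneg s), hm hs]
        refine (ENNReal.ofReal_le_ofReal (hg_le s hs)).trans_eq ?_
        rw [ENNReal.ofReal_mul (by positivity), ofReal_measureReal, ENNReal.ofReal_coe_nnreal]
        rfl
      · simp [m, hs])
    (by
      intro s t hs ht hst
      rw [hm hs, hm ht, hm (hs.union ht), ← map_add]
      congr 1
      exact indicatorConstLp_disjoint_union hs ht _ _ hst 1)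
    (fun s hs => dif_neg hs)
  have hv s : v s = m s := rfl
  let ν : Measure Ω := Measure.ofMeasurable (fun s _ => ENNReal.ofReal (v s)) (by simp)
    (fun s hs hd => by
      rw [v.of_disjoint_iUnion hs hd]
      exact ENNReal.ofReal_tsum_of_nonneg (fun i => hm_nonneg _) (v.m_iUnion hs hd).summable)
  have hν {s} (hs : MeasurableSet s) : ν s = ENNReal.ofReal (g (ι s hs)) := by
    rw [Measure.ofMeasurable_apply s hs, hv, hm hs]
  have hPν : P ≤ ν := Measure.le_iff.2 fun s hs => by
    rw [hν hs, ← ofReal_measureReal (μ := P)]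
    exact ENNReal.ofReal_le_ofReal (hg_ge s hs)
  have hνP : ν ≤ lam • P := Measure.le_iff.2 fun s hs => by
    rw [hν hs]
    refine (ENNReal.ofReal_le_ofReal (hg_le s hs)).trans_eq ?_
    rw [ENNReal.ofReal_mul (by positivity), ofReal_measureReal, ENNReal.ofReal_coe_nnreal]
    rfl
  refine ⟨ν, hPν, hνP, ?_⟩
  have hac : ν ≪ P := (Measure.absolutelyContinuous_of_le hνP).trans
    (Measure.smul_absolutelyContinuous)
  have hint {f : Ω → ℝ} (hf : Integrable f P) : Integrable f ν :=
    (hf.smul_measure_nnreal (c := lam)).mono_measure hνP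
  -- Both sides are `lam`-Lipschitz in the `L¹(P)` norm, so it is enough to compare them on
  -- indicators and sums.
  have hclosed : IsClosed {f : Ω →₁[P] ℝ | g f = ∫ ω, f ω ∂ν} := by
    refine isClosed_eq ?_ ?_
    · exact (g.mkContinuous lam hg_norm).continuous
    · refine (LipschitzWith.of_dist_le_mul (K := lam) fun f h => ?_).continuous
      have hfh : (fun ω => f ω - h ω) =ᵐ[P] ⇑(f - h) := (Lp.coeFn_sub f h).symm
      rw [dist_eq_norm, dist_eq_norm, ← integral_sub (hint (L1.integrable_coeFn f))
        (hint (L1.integrable_coeFn h)), integral_congr_ae (hac.ae_le hfh),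
        L1.norm_eq_integral_norm]
      refine (norm_integral_le_integral_norm _).trans ?_
      have hn := (L1.integrable_coeFn (f - h)).norm
      refine (integral_mono_measure hνP (Eventually.of_forall fun _ => norm_nonneg _)
        (hn.smul_measure_nnreal (c := lam))).trans_eq ?_
      rw [integral_smul_nnreal_measure]
      rfl
  refine fun f => Lp.induction ENNReal.one_ne_top (motive := fun f => g f = ∫ ω, f ω ∂ν)
    ?_ ?_ hclosed f
  · intro c s hs hs'
    have h1 : (Lp.simpleFunc.indicatorConst 1 hs hs'.ne c : Ω →₁[P] ℝ) = c • ι s hs := by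
      rw [Lp.simpleFunc.coe_indicatorConst]
      ext1
      filter_upwards [indicatorConstLp_coeFn (p := 1) (hs := hs) (hμs := hs'.ne) (c := c),
        Lp.coeFn_smul c (ι s hs), hι s hs] with ω h1 h2 h3
      rw [h1, h2, Pi.smul_apply, h3]
      by_cases hω : ω ∈ s <;> simp [hω]
    have h2 : ⇑(c • ι s hs) =ᵐ[ν] s.indicator fun _ => c := by
      filter_upwards [hac.ae_le (Lp.coeFn_smul c (ι s hs)), hac.ae_le (hι s hs)] with ω h2 h3
      rw [h2, Pi.smul_apply, h3]
      by_cases hω : ω ∈ s <;> simp [hω]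
    rw [h1, integral_congr_ae h2, integral_indicator_const _ hs, map_smul, smul_eq_mul,
      smul_eq_mul, mul_comm, Measure.real, hν hs,
      ENNReal.toReal_ofReal (measureReal_nonneg.trans (hg_ge s hs))]
  · intro x y hx hy _ h1 h2
    rw [map_add, h1, h2, ← integral_add (hint (L1.integrable_coeFn _))
      (hint (L1.integrable_coeFn _))]
    exact integral_congr_ae (hac.ae_le (Lp.coeFn_add _ _).symm)

/-- If the gain-loss ratio is at most `lam` on a linear space of integrable variables, then this
space is annihilated by a measure with density between `1` and `lam`. -/
theorem exists_measure_integral_eq_zero [IsProbabilityMeasure P] {lam : ℝ≥0} (hlam : 1 ≤ lam)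
    (D : Submodule ℝ (Ω → ℝ)) (hD : ∀ x ∈ D, Integrable x P)
    (h : ∀ x ∈ D, ∫⁻ ω, ENNReal.ofReal (x ω) ∂P ≤ lam * ∫⁻ ω, ENNReal.ofReal (-x ω) ∂P) :
    ∃ ν : Measure Ω, P ≤ ν ∧ ν ≤ lam • P ∧ ∀ x ∈ D, ∫ ω, x ω ∂ν = 0 := by
  let D' : Submodule ℝ (Ω →₁[P] ℝ) :=
    { carrier := {f | ∃ x ∈ D, f =ᵐ[P] x}
      add_mem' := by
        rintro f g ⟨x, hx, hfx⟩ ⟨y, hy, hgy⟩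
        exact ⟨x + y, D.add_mem hx hy, (Lp.coeFn_add f g).trans (hfx.add hgy)⟩
      zero_mem' := ⟨0, D.zero_mem, Lp.coeFn_zero _ _ _⟩
      smul_mem' := by
        rintro c f ⟨x, hx, hfx⟩
        exact ⟨c • x, D.smul_mem c hx, (Lp.coeFn_smul c f).trans (hfx.const_smul c)⟩ }
  -- The functional to extend is zero on `D'`; nonnegativity of `supportFunctional` at `x` is the
  -- gain-loss bound for `-x`.
  obtain ⟨g, hg0, hg⟩ := exists_extension_of_le_sublinear (⟨D', 0⟩ : (Ω →₁[P] ℝ) →ₗ.[ℝ] ℝ)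
    (supportFunctional P lam) (supportFunctional_smul _) (supportFunctional_add_le _)
    (by
      rintro ⟨f, x, hx, hfx⟩
      change 0 ≤ supportFunctional P lam f
      rw [supportFunctional_congr hfx]
      refine integral_max_mul_nonneg (hD x hx) hlam ?_
      simpa using h (-x) (D.neg_mem hx))
  obtain ⟨ν, h1, h2, h3⟩ := exists_measure_of_le_supportFunctional hlam g hg
  refine ⟨ν, h1, h2, fun x hx => ?_⟩
  have hac : ν ≪ P := (Measure.absolutelyContinuous_of_le h2).trans
    (Measure.smul_absolutelyContinuous)
  have hx1 := (hD x hx).coeFn_toL1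
  rw [← integral_congr_ae (hac.ae_le hx1), ← h3]
  exact hg0 ⟨(hD x hx).toL1 x, x, hx, hx1⟩

end Duality

/-! ### Discretisation of stopping times from the right, and optional stopping -/

variable {Ω : Type*} {mΩ : MeasurableSpace Ω} {T : ℝ≥0} {d : ℕ}

/-- The `k`-th point of the grid of mesh `1 / (n + 1)` on `[0, T]`, capped at `T`. -/
noncomputable def gridPoint (T : ℝ≥0) (n k : ℕ) : Time T :=
  ⟨min T (k / (n + 1)), Set.mem_Iic.2 (min_le_left _ _)⟩

@[simp] lemma coe_gridPoint (n k : ℕ) :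
    (gridPoint T n k : ℝ≥0) = min T (k / (n + 1)) := rfl

/-- The index of the first point of the grid of mesh `1 / (n + 1)` which is at least `t`. -/
noncomputable def gridIndex (n : ℕ) (t : Time T) : ℕ := ⌈((n : ℝ≥0) + 1) * t⌉₊

/-- The first point of the grid of mesh `1 / (n + 1)` which is at least `t`. -/
noncomputable def gridCeil (n : ℕ) (t : Time T) : Time T := gridPoint T n (gridIndex n t)

@[simp] lemma coe_gridCeil (n : ℕ) (t : Time T) :
    (gridCeil n t : ℝ≥0) = min T (gridIndex n t / (n + 1)) := rfl

lemma coe_time_le (t : Time T) : (t : ℝ≥0) ≤ T := Set.mem_Iic.1 t.2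

lemma le_gridCeil (n : ℕ) (t : Time T) : t ≤ gridCeil n t := by
  rw [← Subtype.coe_le_coe, coe_gridCeil]
  refine le_min (coe_time_le t) ?_
  rw [le_div_iff₀ (by positivity), mul_comm]
  exact Nat.le_ceil _

/-- Galois connection between ceiling and floor; for `s < T` the cap at `T` plays no role. It places
the event that the rounded time is at most `s` in the σ-algebra of a grid point before `s`. -/
lemma gridCeil_le_iff_of_lt_top (n : ℕ) (t : Time T) {s : Time T} (hs : (s : ℝ≥0) < T) :
    gridCeil n t ≤ s ↔ t ≤ gridPoint T n ⌊((n : ℝ≥0) + 1) * s⌋₊ := by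
  rw [← Subtype.coe_le_coe, ← Subtype.coe_le_coe, coe_gridCeil, coe_gridPoint, min_le_iff, or_iff_right hs.not_ge, le_min_iff, and_iff_right (coe_time_le t),
    div_le_iff₀ (by positivity), le_div_iff₀ (by positivity), mul_comm (s : ℝ≥0),
    ← Nat.le_floor_iff (by positivity), gridIndex, Nat.ceil_le, mul_comm (t : ℝ≥0)]

lemma gridPoint_floor_le (n : ℕ) (s : Time T) :
    gridPoint T n ⌊((n : ℝ≥0) + 1) * s⌋₊ ≤ s := by
  rw [← Subtype.coe_le_coe, coe_gridPoint]
  refine min_le_of_right_le ?_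
  rw [div_le_iff₀ (by positivity), mul_comm (s : ℝ≥0)]
  exact Nat.floor_le (by positivity)

lemma tendsto_gridCeil (t : Time T) :
    Tendsto (fun n => gridCeil n t) atTop (𝓝[Set.Ici t] t) := by
  refine tendsto_nhdsWithin_iff.2 ⟨?_, Eventually.of_forall fun n => le_gridCeil n t⟩
  rw [tendsto_subtype_rng]
  refine tendsto_of_tendsto_of_tendsto_of_le_of_le (g := fun _ => (t : ℝ≥0))
    (h := fun n : ℕ => (t : ℝ≥0) + 1 / ((n : ℝ≥0) + 1)) tendsto_const_nhds ?_
    (fun n => le_gridCeil n t) ?_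
  · simpa using tendsto_const_nhds.add (tendsto_one_div_add_atTop_nhds_zero_nat (𝕜 := ℝ≥0))
  · intro n
    refine min_le_of_right_le ?_
    rw [div_le_iff₀ (by positivity), add_mul, one_div,
      inv_mul_cancel₀ (by positivity), mul_comm (t : ℝ≥0)]
    exact (Nat.ceil_lt_add_one (by positivity)).le

lemma isStoppingTime_gridCeil {𝓕 : Filtration (Time T) mΩ} {τ : Ω → Time T}
    (hτ : IsStoppingTime 𝓕 (fun ω => (τ ω : WithTop (Time T)))) (n : ℕ) :
    IsStoppingTime 𝓕 (fun ω => (gridCeil n (τ ω) : WithTop (Time T))) := by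
  intro s
  rcases (coe_time_le s).eq_or_lt with hs | hs
  · have h ω : gridCeil n (τ ω) ≤ s := by
      rw [← Subtype.coe_le_coe, hs]
      exact coe_time_le _
    simp [h]
  · have := 𝓕.mono (gridPoint_floor_le n s) _ (hτ (gridPoint T n ⌊((n : ℝ≥0) + 1) * s⌋₊))
    simpa only [WithTop.coe_le_coe, gridCeil_le_iff_of_lt_top n _ hs] using this

lemma measurable_stoppingTime {𝓕 : Filtration (Time T) mΩ} {τ : Ω → Time T}
    (hτ : IsStoppingTime 𝓕 (fun ω => (τ ω : WithTop (Time T)))) : Measurable τ := by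
  refine measurable_of_Iic fun s => 𝓕.le s _ ?_
  simpa only [WithTop.coe_le_coe, Set.preimage, Set.mem_Iic] using hτ s

lemma measurable_gridCeil_value {S : Time T → Ω → Vec d} (hS : ∀ t, Measurable (S t))
    {τ : Ω → Time T} (hτ : Measurable τ) (n : ℕ) :
    Measurable fun ω => S (gridCeil n (τ ω)) ω := by
  have h1 : Measurable (Function.uncurry fun (k : ℕ) (ω : Ω) => S (gridPoint T n k) ω) :=
    measurable_from_prod_countable_right fun k => hS (gridPoint T n k)
  have h2 : Measurable fun ω => gridIndex n (τ ω) :=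
    Nat.measurable_ceil.comp (measurable_const.mul (measurable_subtype_coe.comp hτ))
  have h3 : Measurable fun ω => (gridIndex n (τ ω), ω) := h2.prodMk measurable_id
  have h4 := h1.comp h3
  exact h4

lemma ae_tendsto_gridCeil_value {S : Time T → Ω → Vec d} {P : Measure Ω}
    (hc : ∀ᵐ ω ∂P, IsCadlagPath fun t => S t ω) (τ : Ω → Time T) :
    ∀ᵐ ω ∂P, Tendsto (fun n => S (gridCeil n (τ ω)) ω) atTop (𝓝 (S (τ ω) ω)) := by
  filter_upwards [hc] with ω hω
  exact (hω (τ ω)).1.tendsto.comp (tendsto_gridCeil (τ ω))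

/-- Rounded times take countably many values, and right continuity makes `S_τ` the almost sure limit
of the values there. -/
lemma aestronglyMeasurable_value {S : Time T → Ω → Vec d} (hS : ∀ t, Measurable (S t))
    {P : Measure Ω} (hc : ∀ᵐ ω ∂P, IsCadlagPath fun t => S t ω)
    {τ : Ω → Time T} (hτ : Measurable τ) :
    AEStronglyMeasurable (fun ω => S (τ ω) ω) P :=
  aestronglyMeasurable_of_tendsto_ae atTop
    (fun n => (measurable_gridCeil_value hS hτ n).aestronglyMeasurable)
    (ae_tendsto_gridCeil_value hc τ)

lemma integrable_value {S : Time T → Ω → Vec d} (hS : ∀ t, Measurable (S t))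
    {P : Measure Ω} (hc : ∀ᵐ ω ∂P, IsCadlagPath fun t => S t ω)
    (hint : ∫⁻ ω, maximalFunctional S ω ∂P < ∞)
    {τ : Ω → Time T} (hτ : Measurable τ) :
    Integrable (fun ω => S (τ ω) ω) P :=
  ⟨aestronglyMeasurable_value hS hc hτ,
    (lintegral_mono fun ω => le_iSup (fun t => ‖S t ω‖ₑ) (τ ω)).trans_lt hint⟩

lemma integrable_inner_value {S : Time T → Ω → Vec d} (hS : ∀ t, Measurable (S t))
    {P : Measure Ω} (hc : ∀ᵐ ω ∂P, IsCadlagPath fun t => S t ω)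
    (hint : ∫⁻ ω, maximalFunctional S ω ∂P < ∞)
    {τ : Ω → Time T} (hτ : Measurable τ) {H : Ω → Vec d} (hH : Measurable H) {C : ℝ}
    (hC : ∀ ω, ‖H ω‖ ≤ C) :
    Integrable (fun ω => inner ℝ (H ω) (S (τ ω) ω)) P := by
  refine ((integrable_value hS hc hint hτ).norm.const_mul C).mono'
    (hH.aestronglyMeasurable.inner (aestronglyMeasurable_value hS hc hτ)) ?_
  refine Eventually.of_forall fun ω => (norm_inner_le_norm _ _).trans ?_
  gcongr
  exact hC ω

/-- Dominated convergence along the discretisations of a random time. -/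
lemma tendsto_integral_inner_gridCeil {S : Time T → Ω → Vec d} (hS : ∀ t, Measurable (S t))
    {P : Measure Ω} (hc : ∀ᵐ ω ∂P, IsCadlagPath fun t => S t ω)
    (hint : ∫⁻ ω, maximalFunctional S ω ∂P < ∞)
    {τ : Ω → Time T} (hτ : Measurable τ) {H : Ω → Vec d} (hH : Measurable H) {C : ℝ}
    (hC : ∀ ω, ‖H ω‖ ≤ C) :
    Tendsto (fun n => ∫ ω, inner ℝ (H ω) (S (gridCeil n (τ ω)) ω) ∂P) atTop
      (𝓝 (∫ ω, inner ℝ (H ω) (S (τ ω) ω) ∂P)) := by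
  have hm n := measurable_gridCeil_value hS hτ n
  -- A countable supremum is measurable, which is not known for `maximalFunctional S`; it still
  -- dominates the sequence.
  let B : Ω → ℝ≥0∞ := fun ω => ⨆ n, ‖S (gridCeil n (τ ω)) ω‖ₑ
  have hB : Measurable B := .iSup fun n => (hm n).enorm
  have hB_int : ∫⁻ ω, B ω ∂P ≠ ∞ :=
    ((lintegral_mono fun ω => iSup_le fun n =>
      le_iSup (fun t => ‖S t ω‖ₑ) (gridCeil n (τ ω))).trans_lt hint).ne
  have hC0 ω : 0 ≤ C := (norm_nonneg _).trans (hC ω)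
  refine tendsto_integral_of_dominated_convergence (fun ω => C * (B ω).toReal)
    (fun n => (hH.inner (hm n)).aestronglyMeasurable)
    ((integrable_toReal_of_lintegral_ne_top hB.aemeasurable hB_int).const_mul C) ?_ ?_
  · intro n
    filter_upwards [ae_lt_top hB hB_int] with ω hω
    refine (norm_inner_le_norm _ _).trans ?_
    gcongr
    · exact hC0 ω
    · exact hC ω
    · rw [← toReal_enorm]
      exact ENNReal.toReal_mono hω.ne (le_iSup (fun n => ‖S (gridCeil n (τ ω)) ω‖ₑ) n)
  · filter_upwards [ae_tendsto_gridCeil_value hc τ] with ω hω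
    exact tendsto_const_nhds.inner hω

/-- Optional stopping for a dominated càdlàg martingale, tested against bounded variables of the
σ-algebra of the stopping time. -/
lemma integral_inner_value_eq_top {𝓕 : Filtration (Time T) mΩ} {Q : Measure Ω}
    [IsProbabilityMeasure Q] {S : Time T → Ω → Vec d} (hM : Martingale S 𝓕 Q)
    (hc : ∀ᵐ ω ∂Q, IsCadlagPath fun t => S t ω)
    (hint : ∫⁻ ω, maximalFunctional S ω ∂Q < ∞) {τ : Ω → Time T}
    (hτ : IsStoppingTime 𝓕 (fun ω => (τ ω : WithTop (Time T)))) {H : Ω → Vec d}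
    (hH : Measurable[hτ.measurableSpace] H) {C : ℝ} (hC : ∀ ω, ‖H ω‖ ≤ C) :
    ∫ ω, inner ℝ (H ω) (S (τ ω) ω) ∂Q = ∫ ω, inner ℝ (H ω) (S ⊤ ω) ∂Q := by
  have hS t : Measurable (S t) := ((hM.1 t).mono (𝓕.le t)).measurable
  have hτm := measurable_stoppingTime hτ
  refine tendsto_nhds_unique (tendsto_integral_inner_gridCeil hS hc hint hτm
    (hH.mono hτ.measurableSpace_le le_rfl) hC) ?_
  -- The discretised integrals do not depend on `n`: the rounded time is at least `τ`, so `H` is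
  -- measurable at it, and optional stopping applies since its range is countable.
  refine tendsto_const_nhds.congr fun n => ?_
  have hn := isStoppingTime_gridCeil hτ n
  have hle := hn.measurableSpace_le
  have hHn : StronglyMeasurable[hn.measurableSpace] H :=
    (hH.mono (hτ.measurableSpace_mono hn fun ω => WithTop.coe_le_coe.2 (le_gridCeil n (τ ω)))
      le_rfl).stronglyMeasurable
  have hcount : (Set.range fun ω => (gridCeil n (τ ω) : WithTop (Time T))).Countable :=
    (Set.countable_range fun k => (gridPoint T n k : WithTop (Time T))).mono
      (by rintro _ ⟨ω, rfl⟩; exact ⟨_, rfl⟩)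
  have h1 := hM.stoppedValue_ae_eq_condExp_of_le_const_of_countable_range hn (n := ⊤)
    (fun ω => WithTop.coe_le_coe.2 le_top) hcount
  have h2 := condExp_stronglyMeasurable_bilin_of_bound (innerSL ℝ (E := Vec d)) hle hHn
    (hM.integrable ⊤) C (Eventually.of_forall hC)
  rw [← integral_condExp hle]
  refine integral_congr_ae ?_
  filter_upwards [h1, h2] with ω h1 h2
  refine h2.trans ?_
  rw [← h1]
  rfl

/-! ### Regularity of semimartingales and integrals of simple gains -/

lemma IsSemimartingale.stronglyAdapted {S : Time T → Ω → Vec d} {𝓕 : Filtration (Time T) mΩ}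
    {P : Measure Ω} (hS : IsSemimartingale S 𝓕 P) : StronglyAdapted 𝓕 S := by
  obtain ⟨M, A, hM, hA, h⟩ := hS
  intro t
  have : S t = M t + A t := funext fun ω => h t ω
  rw [this]
  exact (hM.adapted t).add (hA.adapted t)

lemma IsSemimartingale.cadlag {S : Time T → Ω → Vec d} {𝓕 : Filtration (Time T) mΩ}
    {P : Measure Ω} (hS : IsSemimartingale S 𝓕 P) :
    ∀ᵐ ω ∂P, IsCadlagPath fun t => S t ω := by
  obtain ⟨M, A, hM, hA, h⟩ := hS
  filter_upwards [hM.cadlag, hA.cadlag] with ω h1 h2 t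
  obtain ⟨l, hl⟩ := (h1 t).2
  obtain ⟨k, hk⟩ := (h2 t).2
  simp only [h]
  exact ⟨(h1 t).1.add (h2 t).1, l + k, hl.add hk⟩

namespace SimpleStrategy

variable {𝓕 : Filtration (Time T) mΩ}

lemma measurable_position (ξ : SimpleStrategy 𝓕 d) (i : Fin ξ.n) : Measurable (ξ.H i) :=
  (ξ.measurable i).mono (ξ.isStoppingTime i.castSucc).measurableSpace_le le_rfl

lemma measurable_position_succ (ξ : SimpleStrategy 𝓕 d) (i : Fin ξ.n) :
    Measurable[(ξ.isStoppingTime i.succ).measurableSpace] (ξ.H i) :=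
  (ξ.measurable i).mono ((ξ.isStoppingTime i.castSucc).measurableSpace_mono
    (ξ.isStoppingTime i.succ)
    fun ω => WithTop.coe_le_coe.2 (ξ.mono ω (Fin.castSucc_le_succ i))) le_rfl

lemma integrable_inner (ξ : SimpleStrategy 𝓕 d) {S : Time T → Ω → Vec d} {P : Measure Ω}
    (hS : ∀ t, Measurable (S t)) (hc : ∀ᵐ ω ∂P, IsCadlagPath fun t => S t ω)
    (hint : ∫⁻ ω, maximalFunctional S ω ∂P < ∞) (i : Fin ξ.n) (j : Fin (ξ.n + 1)) :
    Integrable (fun ω => inner ℝ (ξ.H i ω) (S (ξ.τ j ω) ω)) P := by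
  obtain ⟨C, hC⟩ := ξ.bounded
  exact integrable_inner_value hS hc hint (measurable_stoppingTime (ξ.isStoppingTime j))
    (ξ.measurable_position i) (hC i)

lemma integrable_gain (ξ : SimpleStrategy 𝓕 d) {S : Time T → Ω → Vec d} {P : Measure Ω}
    (hS : ∀ t, Measurable (S t)) (hc : ∀ᵐ ω ∂P, IsCadlagPath fun t => S t ω)
    (hint : ∫⁻ ω, maximalFunctional S ω ∂P < ∞) : Integrable (ξ.gain S) P := by
  unfold gain
  simp only [inner_sub_right]
  exact integrable_finsetSum _ fun i _ =>
    (ξ.integrable_inner hS hc hint i _).sub (ξ.integrable_inner hS hc hint i _)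

/-- Each `H i` is measurable at both ends of its holding period, so tested against `H i` both values
of `S` integrate like `S_T` and cancel. -/
lemma integral_gain_eq_zero (ξ : SimpleStrategy 𝓕 d) {S : Time T → Ω → Vec d} {Q : Measure Ω}
    [IsProbabilityMeasure Q] (hM : Martingale S 𝓕 Q)
    (hc : ∀ᵐ ω ∂Q, IsCadlagPath fun t => S t ω)
    (hint : ∫⁻ ω, maximalFunctional S ω ∂Q < ∞) : ∫ ω, ξ.gain S ω ∂Q = 0 := by
  have hS t : Measurable (S t) := ((hM.1 t).mono (𝓕.le t)).measurable
  obtain ⟨C, hC⟩ := ξ.bounded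
  unfold gain
  simp only [inner_sub_right]
  refine (integral_finsetSum _ fun i _ => (ξ.integrable_inner hS hc hint i _).sub
    (ξ.integrable_inner hS hc hint i _)).trans (Finset.sum_eq_zero fun i _ => ?_)
  simp only [Pi.sub_apply]
  rw [integral_sub (ξ.integrable_inner hS hc hint i _) (ξ.integrable_inner hS hc hint i _),
    integral_inner_value_eq_top hM hc hint (ξ.isStoppingTime i.succ)
      (ξ.measurable_position_succ i) (hC i),
    integral_inner_value_eq_top hM hc hint (ξ.isStoppingTime i.castSucc)
      (ξ.measurable i) (hC i), sub_self]

end SimpleStrategy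

/-! ### Weak duality -/

lemma lintegral_ofReal_eq_lintegral_ofReal_neg {Q : Measure Ω} {K : Ω → ℝ} (hK : Integrable K Q)
    (h : ∫ ω, K ω ∂Q = 0) :
    ∫⁻ ω, ENNReal.ofReal (K ω) ∂Q = ∫⁻ ω, ENNReal.ofReal (-K ω) ∂Q := by
  rw [integral_eq_lintegral_pos_part_sub_lintegral_neg_part hK, sub_eq_zero] at h
  exact (ENNReal.toReal_eq_toReal_iff' hK.lintegral_lt_top.ne hK.neg.lintegral_lt_top.ne).1 h

lemma le_essSup_rnDeriv_smul {P Q : Measure Ω} [IsFiniteMeasure P] [IsFiniteMeasure Q]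
    (h : Q ≪ P) : Q ≤ essSup (Q.rnDeriv P) P • P := by
  conv_lhs => rw [← Measure.withDensity_rnDeriv_eq Q P h]
  rw [← withDensity_const]
  exact withDensity_mono (ENNReal.ae_le_essSup _)

lemma essInf_rnDeriv_smul_le {P Q : Measure Ω} [IsFiniteMeasure P] [IsFiniteMeasure Q]
    (h : Q ≪ P) : essInf (Q.rnDeriv P) P • P ≤ Q := by
  conv_rhs => rw [← Measure.withDensity_rnDeriv_eq Q P h]
  rw [← withDensity_const]
  exact withDensity_mono ae_essInf_le

/-- The gain-loss ratios are bounded by the density ratio of any equivalent martingale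
probability. -/
theorem bestGainLoss_le_densityRatio {P Q : Measure Ω} [IsProbabilityMeasure P]
    {𝓕 : Filtration (Time T) mΩ} {S : Time T → Ω → Vec d}
    (hc : ∀ᵐ ω ∂P, IsCadlagPath fun t => S t ω)
    (hint : ∫⁻ ω, maximalFunctional S ω ∂P < ∞) (hQ : IsEquivMartingaleProb S 𝓕 P Q) :
    bestGainLoss S 𝓕 P ≤ densityRatio P Q := by
  have := hQ.isProbabilityMeasure
  set C := essSup (Q.rnDeriv P) P with hC
  set c := essInf (Q.rnDeriv P) P with hc'
  have hQC : Q ≤ C • P := le_essSup_rnDeriv_smul hQ.absolutelyContinuous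
  have hcQ : c • P ≤ Q := essInf_rnDeriv_smul_le hQ.absolutelyContinuous
  -- Equal total masses give `c ≤ 1 ≤ C`. This rules out `∞ / ∞` and `0 / 0`, so the ratio is `∞`
  -- when `C = ∞` or `c = 0`.
  have hC1 : 1 ≤ C := by simpa using hQC Set.univ
  have hc1 : c ≤ 1 := by simpa using hcQ Set.univ
  have hc_top : c ≠ ∞ := ne_top_of_le_ne_top ENNReal.one_ne_top hc1
  have hr : densityRatio P Q = C / c := rfl
  rcases eq_or_ne C ∞ with hCt | hCt
  · simp [hr, hCt, ENNReal.top_div_of_ne_top hc_top]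
  rcases eq_or_ne c 0 with hc0 | hc0
  · simp [hr, hc0, ENNReal.div_zero (zero_lt_one.trans_le hC1).ne']
  have hcQ' := hQ.absolutelyContinuous.ae_le hc
  have hintQ : ∫⁻ ω, maximalFunctional S ω ∂Q < ∞ := by
    refine (lintegral_mono' hQC le_rfl).trans_lt ?_
    rw [lintegral_smul_measure]
    exact ENNReal.mul_lt_top hCt.lt_top hint
  have hS t : Measurable (S t) := ((hQ.martingale.1 t).mono (𝓕.le t)).measurable
  refine iSup₂_le fun K hK => ?_
  obtain ⟨⟨ξ, rfl⟩, -⟩ := hK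
  have key := lintegral_ofReal_eq_lintegral_ofReal_neg (ξ.integrable_gain hS hcQ' hintQ)
    (ξ.integral_gain_eq_zero hQ.martingale hcQ' hintQ)
  refine ENNReal.div_le_of_le_mul ?_
  rw [hr, ENNReal.div_eq_inv_mul, mul_assoc]
  rw [← ENNReal.mul_le_mul_iff_right hc0 hc_top, ← mul_assoc c,
    ENNReal.mul_inv_cancel hc0 hc_top, one_mul]
  calc c * ∫⁻ ω, ENNReal.ofReal (ξ.gain S ω) ∂P
      = ∫⁻ ω, ENNReal.ofReal (ξ.gain S ω) ∂(c • P) := by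
        rw [lintegral_smul_measure, smul_eq_mul]
    _ ≤ ∫⁻ ω, ENNReal.ofReal (ξ.gain S ω) ∂Q := lintegral_mono' hcQ le_rfl
    _ = ∫⁻ ω, ENNReal.ofReal (-ξ.gain S ω) ∂Q := key
    _ ≤ ∫⁻ ω, ENNReal.ofReal (-ξ.gain S ω) ∂(C • P) := lintegral_mono' hQC le_rfl
    _ = C * ∫⁻ ω, ENNReal.ofReal (-ξ.gain S ω) ∂P := by
        rw [lintegral_smul_measure, smul_eq_mul]

/-! ### The linear space of gains at deterministic dates -/

section DeterministicGains

/-- The terminal gains of the bounded strategies that trade only at the deterministic dates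
`e 0, …, e n`. -/
def gridGains (S : Time T → Ω → Vec d) (𝓕 : Filtration (Time T) mΩ) {n : ℕ}
    (e : Fin (n + 1) → Time T) : Set (Ω → ℝ) :=
  {x | ∃ H : Fin n → Ω → Vec d, (∀ i, Measurable[𝓕 (e i.castSucc)] (H i)) ∧
    (∃ C : ℝ, ∀ i ω, ‖H i ω‖ ≤ C) ∧
    x = fun ω => ∑ i, inner ℝ (H i ω) (S (e i.succ) ω - S (e i.castSucc) ω)}

variable {S : Time T → Ω → Vec d} {𝓕 : Filtration (Time T) mΩ}

lemma gridGains_subset_gains {n : ℕ} {e : Fin (n + 1) → Time T} (he : Monotone e) :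
    gridGains S 𝓕 e ⊆ gains S 𝓕 := by
  rintro x ⟨H, hH, hC, rfl⟩
  refine ⟨⟨n, fun i _ => e i, fun i => isStoppingTime_const 𝓕 (e i), fun _ => he, H,
    fun i => ?_, hC⟩, rfl⟩
  rw [IsStoppingTime.measurableSpace_const]
  exact hH i

lemma zero_mem_gridGains {n : ℕ} (e : Fin (n + 1) → Time T) : 0 ∈ gridGains S 𝓕 e :=
  ⟨0, fun _ => measurable_const, ⟨0, by simp⟩, by ext; simp⟩

lemma add_mem_gridGains {n : ℕ} {e : Fin (n + 1) → Time T} {x y : Ω → ℝ}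
    (hx : x ∈ gridGains S 𝓕 e) (hy : y ∈ gridGains S 𝓕 e) : x + y ∈ gridGains S 𝓕 e := by
  obtain ⟨H, hH, ⟨C, hC⟩, rfl⟩ := hx
  obtain ⟨H', hH', ⟨C', hC'⟩, rfl⟩ := hy
  refine ⟨H + H', fun i => (hH i).add (hH' i), ⟨C + C', fun i ω => ?_⟩, ?_⟩
  · exact (norm_add_le _ _).trans (add_le_add (hC i ω) (hC' i ω))
  · ext ω
    simp [inner_add_left, Finset.sum_add_distrib]

lemma smul_mem_gridGains {n : ℕ} {e : Fin (n + 1) → Time T} {x : Ω → ℝ} (c : ℝ)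
    (hx : x ∈ gridGains S 𝓕 e) : c • x ∈ gridGains S 𝓕 e := by
  obtain ⟨H, hH, ⟨C, hC⟩, rfl⟩ := hx
  refine ⟨c • H, fun i => (hH i).const_smul c, ⟨‖c‖ * C, fun i ω => ?_⟩, ?_⟩
  · simp only [Pi.smul_apply, norm_smul]
    gcongr
    exact hC i ω
  · ext ω
    simp [inner_smul_left, Finset.mul_sum]

/-- Telescoping of increments over the part of an ordered grid between two of its points. -/
lemma sum_ite_sub_eq {E : Type*} [AddCommGroup E] {ι : Type*} [LinearOrder ι] {n : ℕ}
    {e : Fin (n + 1) → ι} (he : StrictMono e) (f : ι → E) {a b : Fin (n + 1)} (hab : a ≤ b) :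
    ∑ i : Fin n, (if e a ≤ e i.castSucc ∧ e i.castSucc < e b then f (e i.succ) - f (e i.castSucc)
      else 0) = f (e b) - f (e a) := by
  -- Clamping indices to `[a, b]` kills the increments outside and turns the conditional sum into a
  -- full telescoping one.
  have h : ∀ i : Fin n, (if e a ≤ e i.castSucc ∧ e i.castSucc < e b then
      f (e i.succ) - f (e i.castSucc) else 0) =
      f (e (max a (min b i.succ))) - f (e (max a (min b i.castSucc))) := by
    intro i
    simp only [he.le_iff_le, he.lt_iff_lt]
    split_ifs with hi
    · have h1 : i.succ ≤ b := Fin.castSucc_lt_iff_succ_le.1 hi.2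
      rw [min_eq_right h1, min_eq_right hi.2.le, max_eq_right hi.1,
        max_eq_right (hi.1.trans (Fin.castSucc_le_succ i))]
    · rw [not_and_or, not_le, not_lt] at hi
      rcases hi with hi | hi
      · have h1 : i.succ ≤ a := Fin.castSucc_lt_iff_succ_le.1 hi
        rw [max_eq_left ((min_le_right _ _).trans h1), max_eq_left ((min_le_right _ _).trans hi.le),
          sub_self]
      · rw [min_eq_left hi, min_eq_left (hi.trans (Fin.castSucc_le_succ i)), sub_self]
  simp only [h]
  have hs : ∀ g : Fin (n + 1) → E, ∑ i : Fin n, (g i.succ - g i.castSucc) = g (Fin.last n) - g 0 := by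
    intro g
    rw [Finset.sum_sub_distrib, sub_eq_sub_iff_add_eq_add, add_comm, ← Fin.sum_univ_succ,
      Fin.sum_univ_castSucc, add_comm]
  rw [hs fun j => f (e (max a (min b j)))]
  simp [Fin.le_last, hab]

/-- The position `H` is held through every grid period between `e a` and `e b`; it stays measurable
at the later dates. -/
lemma inner_increment_mem_gridGains {n : ℕ} {e : Fin (n + 1) → Time T} (he : StrictMono e)
    {a b : Fin (n + 1)} (hab : a ≤ b) {H : Ω → Vec d} (hH : Measurable[𝓕 (e a)] H) {C : ℝ}
    (hC : ∀ ω, ‖H ω‖ ≤ C) :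
    (fun ω => inner ℝ (H ω) (S (e b) ω - S (e a) ω)) ∈ gridGains S 𝓕 e := by
  refine ⟨fun i => if e a ≤ e i.castSucc ∧ e i.castSucc < e b then H else 0, fun i => ?_,
    ⟨C, fun i ω => ?_⟩, ?_⟩
  · dsimp only
    split_ifs with h
    · exact hH.mono (𝓕.mono h.1) le_rfl
    · exact measurable_const
  · dsimp only
    split_ifs with h
    · exact hC ω
    · simpa using (norm_nonneg _).trans (hC ω)
  · ext ω
    rw [← sum_ite_sub_eq he (fun t => S t ω) hab, inner_sum]
    refine Finset.sum_congr rfl fun i _ => ?_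
    by_cases h : e a ≤ e i.castSucc ∧ e i.castSucc < e b <;> simp [h]

/-- The linear space of the terminal gains of bounded strategies that trade at finitely many
deterministic dates. -/
def deterministicGains (S : Time T → Ω → Vec d) (𝓕 : Filtration (Time T) mΩ) :
    Submodule ℝ (Ω → ℝ) where
  -- Asking for membership on all sufficiently fine grids lets two gains be added on any grid
  -- containing both thresholds.
  carrier := {x | ∃ F₀ : Finset (Time T), ∀ F, F₀ ⊆ F → ∀ n (h : F.card = n + 1),
    x ∈ gridGains S 𝓕 (F.orderEmbOfFin h)}
  add_mem' := by
    rintro x y ⟨F, hF⟩ ⟨G, hG⟩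
    exact ⟨F ∪ G, fun K hK n h => add_mem_gridGains
      (hF K (Finset.union_subset_left hK) n h) (hG K (Finset.union_subset_right hK) n h)⟩
  zero_mem' := ⟨∅, fun _ _ _ _ => zero_mem_gridGains _⟩
  smul_mem' := by
    rintro c x ⟨F, hF⟩
    exact ⟨F, fun K hK n h => smul_mem_gridGains c (hF K hK n h)⟩

lemma deterministicGains_subset_gains :
    (deterministicGains S 𝓕 : Set (Ω → ℝ)) ⊆ gains S 𝓕 := by
  rintro x ⟨F, hF⟩
  -- The date `⊥` is inserted only to make the grid nonempty.
  obtain ⟨n, hn⟩ := Nat.exists_eq_succ_of_ne_zero (Finset.card_ne_zero_of_mem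
    (Finset.mem_insert_self (⊥ : Time T) F))
  exact gridGains_subset_gains (OrderEmbedding.monotone _)
    (hF (insert ⊥ F) (Finset.subset_insert _ _) n hn)

lemma inner_increment_mem_deterministicGains {s t : Time T} (hst : s ≤ t) {H : Ω → Vec d}
    (hH : Measurable[𝓕 s] H) {C : ℝ} (hC : ∀ ω, ‖H ω‖ ≤ C) :
    (fun ω => inner ℝ (H ω) (S t ω - S s ω)) ∈ deterministicGains S 𝓕 := by
  refine ⟨{s, t}, fun F hF n h => ?_⟩
  have hr := F.range_orderEmbOfFin h
  obtain ⟨a, rfl⟩ : s ∈ Set.range (F.orderEmbOfFin h) := hr ▸ hF (by simp)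
  obtain ⟨b, rfl⟩ : t ∈ Set.range (F.orderEmbOfFin h) := hr ▸ hF (by simp)
  exact inner_increment_mem_gridGains (OrderEmbedding.strictMono _)
    ((OrderEmbedding.le_iff_le _).1 hst) hH hC

end DeterministicGains

/-! ### Strong duality: construction of the martingale probability -/

lemma rnDeriv_le_of_le_smul {P Q : Measure Ω} [IsFiniteMeasure P] [IsFiniteMeasure Q]
    {C : ℝ≥0∞} (h : Q ≪ P) (hC : Q ≤ C • P) : ∀ᵐ ω ∂P, Q.rnDeriv P ω ≤ C := by
  refine ae_le_of_forall_setLIntegral_le_of_sigmaFinite (Measure.measurable_rnDeriv Q P)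
    fun s hs _ => ?_
  rw [Measure.setLIntegral_rnDeriv h, setLIntegral_const]
  exact hC s

lemma le_rnDeriv_of_smul_le {P Q : Measure Ω} [IsFiniteMeasure P] [IsFiniteMeasure Q]
    {c : ℝ≥0∞} (h : Q ≪ P) (hc : c • P ≤ Q) : ∀ᵐ ω ∂P, c ≤ Q.rnDeriv P ω := by
  refine ae_le_of_forall_setLIntegral_le_of_sigmaFinite measurable_const
    fun s hs _ => ?_
  rw [Measure.setLIntegral_rnDeriv h, setLIntegral_const]
  exact hc s

/-- A process whose increments are orthogonal to all bounded positions is a martingale. -/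
lemma martingale_of_integral_inner_increment_eq_zero {𝓕 : Filtration (Time T) mΩ}
    {S : Time T → Ω → Vec d} {Q : Measure Ω} [IsFiniteMeasure Q] (hS : StronglyAdapted 𝓕 S)
    (hint : ∀ t, Integrable (S t) Q)
    (h : ∀ s t, s ≤ t → ∀ A, MeasurableSet[𝓕 s] A → ∀ v : Vec d,
      ∫ ω, inner ℝ (A.indicator (fun _ => v) ω) (S t ω - S s ω) ∂Q = 0) :
    Martingale S 𝓕 Q := by
  refine ⟨hS, fun s t hst => (ae_eq_condExp_of_forall_setIntegral_eq (𝓕.le s) (hint t)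
    (fun _ _ _ => (hint s).integrableOn) (fun A hA _ => ?_) (hS s).aestronglyMeasurable).symm⟩
  rw [eq_comm, ← sub_eq_zero, ← integral_sub (hint t).integrableOn (hint s).integrableOn]
  -- Pairing with every `v` reduces the vector identity on `A` to the scalar hypothesis for `1_A v`.
  refine ext_inner_left ℝ fun v => ?_
  rw [inner_zero_right, ← integral_inner (f := fun ω => S t ω - S s ω) ((hint t).sub (hint s)).integrableOn,
    ← integral_indicator (𝓕.le s _ hA), ← h s t hst A hA v]
  congr with ω
  by_cases hω : ω ∈ A <;> simp [hω]

/-- Normalise the annihilating measure `ν` by its mass `a`: the density lies between `1 / a` and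
`lam / a`, and `a` cancels in the ratio. -/
theorem exists_mem_boundedMartingaleProbs {P : Measure Ω} [IsProbabilityMeasure P]
    {𝓕 : Filtration (Time T) mΩ} {S : Time T → Ω → Vec d} (hS : StronglyAdapted 𝓕 S)
    (hint : ∀ t, Integrable (S t) P) (hD : ∀ x ∈ deterministicGains S 𝓕, Integrable x P)
    {lam : ℝ≥0} (hlam : 1 ≤ lam)
    (h : ∀ x ∈ deterministicGains S 𝓕,
      ∫⁻ ω, ENNReal.ofReal (x ω) ∂P ≤ lam * ∫⁻ ω, ENNReal.ofReal (-x ω) ∂P) :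
    ∃ Q ∈ boundedMartingaleProbs S 𝓕 P, densityRatio P Q ≤ lam := by
  obtain ⟨ν, hPν, hνP, hν⟩ := exists_measure_integral_eq_zero hlam _ hD h
  have hνac : ν ≪ P := (Measure.absolutelyContinuous_of_le hνP).trans
    Measure.smul_absolutelyContinuous
  set a := ν Set.univ with ha
  have ha1 : 1 ≤ a := by simpa using hPν Set.univ
  have ha_lam : a ≤ lam := by
    have := hνP Set.univ
    rwa [Measure.smul_apply, measure_univ (μ := P), ENNReal.smul_def, smul_eq_mul,
      mul_one] at this
  have ha0 : a ≠ 0 := (zero_lt_one.trans_le ha1).ne'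
  have ha_top : a ≠ ∞ := ne_top_of_le_ne_top ENNReal.coe_ne_top ha_lam
  have hi0 : a⁻¹ ≠ 0 := ENNReal.inv_ne_zero.2 ha_top
  have hi_top : a⁻¹ ≠ ∞ := ENNReal.inv_ne_top.2 ha0
  have : IsProbabilityMeasure (a⁻¹ • ν) := ⟨by
    rw [Measure.smul_apply, smul_eq_mul, ← ha, ENNReal.inv_mul_cancel ha0 ha_top]⟩
  have hQP : a⁻¹ • ν ≪ P := Measure.smul_absolutelyContinuous.trans hνac
  have hPQ : P ≪ a⁻¹ • ν :=
    (Measure.absolutelyContinuous_of_le hPν).trans (Measure.absolutelyContinuous_smul hi0)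
  have hQle : a⁻¹ • ν ≤ (a⁻¹ * lam) • P := Measure.le_intro fun s _ _ => by
    rw [mul_smul, Measure.smul_apply, Measure.smul_apply a⁻¹]
    exact mul_le_mul_right (hνP s) _
  have hleQ : a⁻¹ • P ≤ a⁻¹ • ν := Measure.le_intro fun s _ _ => by
    rw [Measure.smul_apply, Measure.smul_apply]
    exact mul_le_mul_right (hPν s) _
  have hu := rnDeriv_le_of_le_smul hQP hQle
  have hl := le_rnDeriv_of_smul_le hQP hleQ
  -- The lower bound must be strict while the density may equal `a⁻¹`, hence the half.
  refine ⟨a⁻¹ • ν, ⟨⟨this, hQP, hPQ, ?_⟩, ⟨(a⁻¹ * lam).toNNReal, ?_⟩,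
    ⟨(a⁻¹ / 2).toNNReal, ?_, ?_⟩⟩, ?_⟩
  · refine martingale_of_integral_inner_increment_eq_zero hS (fun t => ?_)
      fun s t hst A hA v => ?_
    · exact ((hint t).smul_measure (ENNReal.mul_ne_top hi_top ENNReal.coe_ne_top)).mono_measure
        hQle
    · rw [integral_smul_measure, hν _ (inner_increment_mem_deterministicGains hst
        (measurable_const.indicator hA) (C := ‖v‖) fun ω => norm_indicator_le_norm_self _ _),
        smul_zero]
  · rwa [ENNReal.coe_toNNReal (ENNReal.mul_ne_top hi_top ENNReal.coe_ne_top)]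
  · exact ENNReal.toNNReal_pos (ENNReal.half_pos hi0).ne' (ENNReal.div_ne_top hi_top (by simp))
  · filter_upwards [hl] with ω hω
    rw [ENNReal.coe_toNNReal (ENNReal.div_ne_top hi_top (by simp))]
    exact (ENNReal.half_lt_self hi0 hi_top).trans_le hω
  · calc densityRatio P (a⁻¹ • ν) ≤ (a⁻¹ * lam) / a⁻¹ :=
        ENNReal.div_le_div (essSup_le_of_ae_le _ hu) (le_essInf_of_ae_le _ hl)
      _ = lam := by rw [mul_comm, ENNReal.mul_div_cancel_right hi0 hi_top]

lemma neg_mem_gains {𝓕 : Filtration (Time T) mΩ} {S : Time T → Ω → Vec d} {K : Ω → ℝ}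
    (hK : K ∈ gains S 𝓕) : -K ∈ gains S 𝓕 := by
  obtain ⟨ξ, rfl⟩ := hK
  refine ⟨{ ξ with
    H := fun i => -ξ.H i
    measurable := fun i => (ξ.measurable i).neg
    bounded := by simpa using ξ.bounded }, ?_⟩
  ext ω
  simp [SimpleStrategy.gain]

/-- Clearing the denominator also covers almost surely zero gains, which the supremum omits but a
linear space contains. -/
lemma lintegral_ofReal_le_bestGainLoss_mul {P : Measure Ω} {𝓕 : Filtration (Time T) mΩ}
    {S : Time T → Ω → Vec d} {K : Ω → ℝ} (hK : K ∈ gains S 𝓕) (hint : Integrable K P)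
    (hb : bestGainLoss S 𝓕 P ≠ ∞) :
    ∫⁻ ω, ENNReal.ofReal (K ω) ∂P ≤
      bestGainLoss S 𝓕 P * ∫⁻ ω, ENNReal.ofReal (-K ω) ∂P := by
  by_cases h0 : K =ᵐ[P] 0
  · have : (fun ω => ENNReal.ofReal (K ω)) =ᵐ[P] 0 := h0.mono fun ω hω => by simp [hω]
    simp [lintegral_congr_ae this]
  · have h : gainLossRatio P K ≤ bestGainLoss S 𝓕 P :=
      le_iSup₂_of_le (f := fun K _ => gainLossRatio P K) K ⟨hK, h0⟩ le_rfl
    exact (ENNReal.div_le_iff_le_mul (Or.inr hb) (Or.inl hint.neg.lintegral_lt_top.ne)).1 h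

/-- If `α^* < 1`, the bounds for `K` and `-K` combine to `E[K⁺] ≤ α^* E[K⁺]`, which forces `E[K⁺] =
E[K⁻] = 0`. -/
lemma one_le_bestGainLoss {P : Measure Ω} {𝓕 : Filtration (Time T) mΩ}
    {S : Time T → Ω → Vec d} {K : Ω → ℝ} (hK : K ∈ gains S 𝓕) (hint : Integrable K P)
    (h0 : ¬ K =ᵐ[P] 0) : 1 ≤ bestGainLoss S 𝓕 P := by
  by_contra! hlt
  have hb := hlt.ne_top
  have h1 := lintegral_ofReal_le_bestGainLoss_mul hK hint hb
  have h2 := lintegral_ofReal_le_bestGainLoss_mul (neg_mem_gains hK) hint.neg hb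
  simp only [Pi.neg_apply, neg_neg] at h2
  set a := ∫⁻ ω, ENNReal.ofReal (K ω) ∂P with ha
  set b := ∫⁻ ω, ENNReal.ofReal (-K ω) ∂P with hb'
  have ha_top : a ≠ ∞ := hint.lintegral_lt_top.ne
  have hba : b ≤ a := h2.trans (mul_le_of_le_one_left zero_le hlt.le)
  have ha0 : a = 0 := by
    by_contra ha0
    refine (h1.trans (mul_le_mul_right hba _)).not_gt ?_
    simpa using (ENNReal.mul_lt_mul_iff_left ha0 ha_top).2 hlt
  have hb0 : b = 0 := le_antisymm (ha0 ▸ hba) zero_le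
  rw [ha, lintegral_eq_zero_iff' hint.aemeasurable.ennreal_ofReal] at ha0
  rw [hb', lintegral_eq_zero_iff' (f := fun ω => ENNReal.ofReal (-K ω))
    hint.aemeasurable.neg.ennreal_ofReal] at hb0
  refine h0 ?_
  filter_upwards [ha0, hb0] with ω h1 h2
  have h1 : K ω ≤ 0 := ENNReal.ofReal_eq_zero.1 h1
  have h2 : -K ω ≤ 0 := ENNReal.ofReal_eq_zero.1 h2
  simp only [Pi.zero_apply]
  linarith

end GainLoss

/-! ### The equivalence and the attained minimum -/

theorem theorem1 {Ω : Type*} {mΩ : MeasurableSpace Ω} {T : ℝ≥0} {d : ℕ}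
    (P : Measure Ω) [IsProbabilityMeasure P]
    (𝓕 : Filtration (GainLoss.Time T) mΩ) (h𝓕 : GainLoss.UsualConditions 𝓕 P)
    (S : GainLoss.Time T → Ω → GainLoss.Vec d) (hS : GainLoss.IsSemimartingale S 𝓕 P)
    (hS_int : ∫⁻ ω, GainLoss.maximalFunctional S ω ∂P < ∞)
    (lam : ℝ) (hlam : 1 < lam) :
    (GainLoss.GainLossFree S 𝓕 P lam ↔
      ∃ Q : Measure Ω, GainLoss.IsEquivMartingaleProb S 𝓕 P Q ∧
        GainLoss.densityRatio P Q < ENNReal.ofReal lam) ∧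
    (GainLoss.GainLossFree S 𝓕 P lam →
      (∃ K ∈ GainLoss.gains S 𝓕, ¬ K =ᵐ[P] 0) →
      IsLeast (GainLoss.densityRatio P '' GainLoss.boundedMartingaleProbs S 𝓕 P)
        (GainLoss.bestGainLoss S 𝓕 P)) := by
  have hc := hS.cadlag
  have hm t : Measurable (S t) := ((hS.stronglyAdapted t).mono (𝓕.le t)).measurable
  have hint : ∀ K ∈ GainLoss.gains S 𝓕, Integrable K P := by
    rintro _ ⟨ξ, rfl⟩
    exact ξ.integrable_gain hm hc hS_int
  have hD x (hx : x ∈ GainLoss.deterministicGains S 𝓕) : x ∈ GainLoss.gains S 𝓕 :=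
    GainLoss.deterministicGains_subset_gains hx
  have hSint t : Integrable (S t) P :=
    GainLoss.integrable_value hm hc hS_int (τ := fun _ => t) measurable_const
  have hlow {Q : Measure Ω} (hQ : GainLoss.IsEquivMartingaleProb S 𝓕 P Q) :=
    GainLoss.bestGainLoss_le_densityRatio hc hS_int hQ
  have hex (hfree : GainLoss.GainLossFree S 𝓕 P lam)
      (hK : ∃ K ∈ GainLoss.gains S 𝓕, ¬ K =ᵐ[P] 0) :
      ∃ Q ∈ GainLoss.boundedMartingaleProbs S 𝓕 P,
        GainLoss.densityRatio P Q = GainLoss.bestGainLoss S 𝓕 P := by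
    obtain ⟨K, hK, hK0⟩ := hK
    have hb : GainLoss.bestGainLoss S 𝓕 P ≠ ∞ := hfree.ne_top
    have h1 := GainLoss.one_le_bestGainLoss hK (hint K hK) hK0
    -- Duality is applied with the constant `α^*` itself rather than `lam`, so that the resulting
    -- `Q` is optimal.
    lift GainLoss.bestGainLoss S 𝓕 P to ℝ≥0 using hb with α hα
    obtain ⟨Q, hQ, hle⟩ := GainLoss.exists_mem_boundedMartingaleProbs hS.stronglyAdapted hSint
      (fun x hx => hint x (hD x hx)) (lam := α) (by exact_mod_cast h1) fun x hx => by
        rw [hα]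
        exact GainLoss.lintegral_ofReal_le_bestGainLoss_mul (hD x hx) (hint x (hD x hx))
          (hα ▸ ENNReal.coe_ne_top)
    exact ⟨Q, hQ, le_antisymm hle (hα ▸ hlow hQ.1)⟩
  refine ⟨⟨fun hfree => ?_, fun ⟨Q, hQ, hlt⟩ => (hlow hQ).trans_lt hlt⟩, fun hfree hK => ?_⟩
  · by_cases hK : ∃ K ∈ GainLoss.gains S 𝓕, ¬ K =ᵐ[P] 0
    · obtain ⟨Q, hQ, hr⟩ := hex hfree hK
      exact ⟨Q, hQ.1, hr.trans_lt hfree⟩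
    -- With no nonzero gain the supremum is over the empty set and is `0`, too small for the
    -- duality; the constant `1` works since all gains vanish.
    · push Not at hK
      obtain ⟨Q, hQ, hr⟩ := GainLoss.exists_mem_boundedMartingaleProbs hS.stronglyAdapted hSint
        (fun x hx => hint x (hD x hx)) (lam := 1) le_rfl fun x hx => by
          have : (fun ω => ENNReal.ofReal (x ω)) =ᵐ[P] 0 :=
            (hK x (hD x hx)).mono fun ω hω => by simp [hω]
          simp [lintegral_congr_ae this]
      refine ⟨Q, hQ.1, hr.trans_lt ?_⟩
      simpa using hlam
  · obtain ⟨Q, hQ, hr⟩ := hex hfree hK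
    refine ⟨⟨Q, hQ, hr⟩, ?_⟩
    rintro _ ⟨Q', hQ', rfl⟩
    exact hlow hQ'.1
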